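/- Let $u>0$ and $\alpha>0$, and let $\rho$ be a probability measure on $[1,\infty)$ for which there is a constant $C>0$ with $C^{-1}r^{-\alpha}\le\rho[r,\infty)\le C r^{-\alpha}$ for all $r\ge 1$. Let $S=\mathbb{R}^2\times[1,\infty)\times(-\pi/2,\pi/2]$, let $\lambda$ be Lebesgue measure on $\mathbb{R}^2$ and let $\nu$ be the uniform probability measure on $(-\pi/2,\pi/2]$. A point $(z,R,V)\in S$ represents the ellipse with center $z$, major axis of size $R$, minor axis of size $1$ and direction $V$. The $(u,\rho)$-ellipses model is the Poisson point process on $S$ with intensity measure $(u\lambda)\otimes\rho\otimes\nu$. Let $P_{u,\rho}$ be its law on the space of point measures on $S$ (locally finite countable sums of Dirac masses) with the $\sigma$-algebra generated by the counting maps $\xi\mapsto\xi(B)$, $B\subset S$ measurable. For $x\in\mathbb{R}^2$ let $\tau_x$ act on $S$ by $(z,R,V)\mapsto(z+x,R,V)$, on point measures by push-forward, and on events by $\tau_x(A)=\{\tau_x(\xi):\xi\in A\}$. Then $P_{u,\rho}$ is ergodic under translations of $\mathbb{R}^2$: every $\tau_x$ preserves $P_{u,\rho}$, and if $A$ is an event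 such that, for every $x\in\mathbb{R}^2$, $\tau_x(A)=A$ up to a $P_{u,\rho}$-null set, then $P_{u,\rho}[A]\in\{0,1\}$. -/

import Mathlib

open MeasureTheory ProbabilityTheory
open scoped ENNReal NNReal

namespace EllipsesModel

/-- A measure on `X` is a point measure if it is a locally finite countable sum of Dirac masses. -/
def IsPointMeasure {X : Type*} [TopologicalSpace X] [MeasurableSpace X] (m : Measure X) : Prop :=
  IsLocallyFiniteMeasure m ∧
    ∃ (ι : Type) (_ : Countable ι) (s : ι → X), m = Measure.sum fun i => Measure.dirac (s i)

/-- The space of point measures (locally finite point configurations, with multiplicities) on `X`.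
As a subtype of `Measure X` it carries the σ-algebra generated by the counting maps
`m ↦ m B`, for `B` measurable. -/
abbrev PointMeasure (X : Type*) [TopologicalSpace X] [MeasurableSpace X] : Type _ :=
  {m : Measure X // IsPointMeasure m}

/-- `P` is the law of a Poisson point process on `X` with intensity measure `μ`. -/
structure IsPoissonLaw {X : Type*} [TopologicalSpace X] [MeasurableSpace X] (μ : Measure X)
    (P : Measure (PointMeasure X)) : Prop where
  /-- `P` is a probability measure. -/
  isProbabilityMeasure : IsProbabilityMeasure P
  /-- The number of points in a set of finite intensity is a Poisson variable. -/
  count_finite : ∀ B : Set X, MeasurableSet B → μ B ≠ ∞ → ∀ k : ℕ,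
    P {ξ | ξ.1 B = k} = poissonMeasure (μ B).toNNReal {k}
  /-- A set of infinite intensity contains infinitely many points almost surely. -/
  count_infinite : ∀ B : Set X, MeasurableSet B → μ B = ∞ → ∀ᵐ ξ ∂P, ξ.1 B = ∞
  /-- The numbers of points in finitely many pairwise disjoint sets are independent. -/
  indep : ∀ (n : ℕ) (B : Fin n → Set X), (∀ i, MeasurableSet (B i)) →
    Pairwise (Function.onFun Disjoint B) →
      iIndepFun (fun (i : Fin n) (ξ : PointMeasure X) => ξ.1 (B i)) P

/-- The Euclidean plane. -/
abbrev Plane : Type := EuclideanSpace ℝ (Fin 2)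

/-- The space `ℝ² × [1, ∞) × (-π/2, π/2]`. The point `(z, R, V)` stands for the ellipse with
center `z`, major axis of size `R`, minor axis of size `1` and direction `V`. -/
abbrev EllipseSpace : Type :=
  Plane × Set.Ici (1 : ℝ) × Set.Ioc (-(Real.pi / 2)) (Real.pi / 2)

/-- The uniform probability measure on the directions `(-π/2, π/2]`. -/
noncomputable def directionLaw : Measure (Set.Ioc (-(Real.pi / 2)) (Real.pi / 2)) :=
  (ENNReal.ofReal Real.pi)⁻¹ • Measure.comap Subtype.val (volume : Measure ℝ)

/-- The law `ρ` on `[1, ∞)` satisfies `C⁻¹ r ^ (-α) ≤ ρ [r, ∞) ≤ C r ^ (-α)` for all `r ≥ 1`,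
for some constant `C > 0`. -/
def HasTailDecay (ρ : Measure (Set.Ici (1 : ℝ))) (α : ℝ) : Prop :=
  ∃ C : ℝ, 0 < C ∧ ∀ r : ℝ, 1 ≤ r →
    C⁻¹ * r ^ (-α) ≤ ρ.real {R | r ≤ (R : ℝ)} ∧ ρ.real {R | r ≤ (R : ℝ)} ≤ C * r ^ (-α)

/-- The intensity measure `(u λ) ⊗ ρ ⊗ ν`, with `λ` Lebesgue measure on the plane and `ν` the
uniform law of the direction. -/
noncomputable def intensity (u : ℝ) (ρ : Measure (Set.Ici (1 : ℝ))) : Measure EllipseSpace :=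
  (ENNReal.ofReal u • (volume : Measure Plane)).prod (ρ.prod directionLaw)

/-- `P` is the law of the `(u, ρ)`-ellipses model. -/
def IsEllipsesModel (u : ℝ) (ρ : Measure (Set.Ici (1 : ℝ)))
    (P : Measure (PointMeasure EllipseSpace)) : Prop :=
  IsPoissonLaw (intensity u ρ) P

/-- Translation by `x` of the center of an ellipse, as a homeomorphism:
`(z, R, V) ↦ (z + x, R, V)`. -/
def shift (x : Plane) : EllipseSpace ≃ₜ EllipseSpace :=
  (Homeomorph.addRight x).prodCongr (Homeomorph.refl _)

theorem IsPointMeasure.map_shift {m : Measure EllipseSpace} (hm : IsPointMeasure m) (x : Plane) :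
    IsPointMeasure (m.map (shift x)) := by
  obtain ⟨hfin, ι, hι, s, rfl⟩ := hm
  have hmeas : Measurable (shift x) := (shift x).continuous.measurable
  refine ⟨⟨fun y => ?_⟩, ι, hι, fun i => shift x (s i), ?_⟩
  · obtain ⟨U, hU, hlt⟩ := hfin.finiteAtNhds ((shift x).symm y)
    refine ⟨(shift x).symm ⁻¹' U, (shift x).symm.continuous.continuousAt hU, ?_⟩
    have h : Measure.map (shift x) (Measure.sum fun i => Measure.dirac (s i))
        ((shift x).symm ⁻¹' U) = (Measure.sum fun i => Measure.dirac (s i)) U := by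
      have := (shift x).toMeasurableEquiv.map_apply
        (μ := Measure.sum fun i => Measure.dirac (s i)) ((shift x).symm ⁻¹' U)
      rw [Homeomorph.toMeasurableEquiv_coe] at this
      rw [this]
      congr 1
      ext z
      simp
    rw [h]
    exact hlt
  · rw [Measure.map_sum hmeas.aemeasurable]
    congr 1
    funext i
    exact Measure.map_dirac' hmeas _

/-- The translation `τ_x` acting on point configurations: every ellipse is translated by `x`. -/
noncomputable def translate (x : Plane) (ξ : PointMeasure EllipseSpace) :
    PointMeasure EllipseSpace :=
  ⟨ξ.1.map (shift x), ξ.2.map_shift x⟩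

end EllipsesModel

/-! The model is mixing, and mixing forces invariant events to be trivial. Translations fix the
intensity, and the intensity determines the law of a Poisson process (`IsPoissonLaw.unique`), so
each `translate x` preserves `P`. Let `A` be invariant. Up to `ε`, it is an event `B` that depends
only on ellipses centered in some ball (`measureDense_restrictedSigma`). A far enough translate of
`B` depends on a disjoint region, hence is independent of `B`
(`IsPoissonLaw.indep_restrictedSigma`), while the same translate of `A` is almost surely `A`. Thus
`P A` is within a multiple of `ε` of `(P A)²`; letting `ε` tend to `0`, `P A` is `0` or `1`.
Locality refers to centers, so the lengths of the ellipses play no role. -/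

namespace EllipsesModel

/-! ### Poisson processes: generating events, uniqueness of the law, independence over disjoint
regions. -/

section PointProcess

variable {X : Type*} [TopologicalSpace X] [MeasurableSpace X]

theorem measurable_count {B : Set X} (hB : MeasurableSet B) :
    Measurable fun ξ : PointMeasure X => ξ.1 B :=
  (Measure.measurable_coe hB).comp measurable_subtype_coe

/-- The σ-algebra of the events that depend only on the points in `K`. -/
noncomputable abbrev restrictedSigma (K : Set X) : MeasurableSpace (PointMeasure X) :=
  MeasurableSpace.comap (fun ξ : PointMeasure X => ξ.1.restrict K) Measure.instMeasurableSpace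

theorem restrictedSigma_le {K : Set X} (hK : MeasurableSet K) :
    restrictedSigma K ≤ (inferInstance : MeasurableSpace (PointMeasure X)) := by
  refine Measurable.comap_le (Measure.measurable_of_measurable_coe _ fun B hB => ?_)
  simp only [Measure.restrict_apply hB]
  exact measurable_count (hB.inter hK)

theorem restrictedSigma_univ :
    restrictedSigma (Set.univ : Set X) = (inferInstance : MeasurableSpace (PointMeasure X)) := by
  simp only [restrictedSigma, Measure.restrict_univ]
  rfl

theorem restrictedSigma_mono {K L : Set X} (hK : MeasurableSet K) (hKL : K ⊆ L) :
    restrictedSigma K ≤ restrictedSigma L := by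
  have h : (fun ξ : PointMeasure X => ξ.1.restrict K)
      = (fun m : Measure X => m.restrict K) ∘ fun ξ : PointMeasure X => ξ.1.restrict L := by
    funext ξ
    simp only [Function.comp, Measure.restrict_restrict hK, Set.inter_eq_left.mpr hKL]
  have hm : Measurable fun m : Measure X => m.restrict K :=
    Measure.measurable_of_measurable_coe _ fun B hB => by
      simpa only [Measure.restrict_apply hB] using Measure.measurable_coe (hB.inter hK)
  rw [restrictedSigma, restrictedSigma, h, ← MeasurableSpace.comap_comp]
  exact MeasurableSpace.comap_mono hm.comap_le

/-- The numbers of points in the cells, inside `K`, of the partition given by `f`. -/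
def cellCounts (K : Set X) {n : ℕ} (f : X → Fin n) (ξ : PointMeasure X) : Fin n → ℝ≥0∞ :=
  fun i => ξ.1 (f ⁻¹' {i} ∩ K)

theorem measurable_cellCounts {K : Set X} (hK : MeasurableSet K) {n : ℕ} {f : X → Fin n}
    (hf : Measurable f) : Measurable (cellCounts K f) :=
  measurable_pi_lambda _ fun i => measurable_count ((hf (measurableSet_singleton i)).inter hK)

theorem cellCounts_comp {K : Set X} (hK : MeasurableSet K) {n k : ℕ} {h : X → Fin n}
    (hh : Measurable h) (φ : Fin n → Fin k) (ξ : PointMeasure X) (i : Fin k) :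
    cellCounts K (φ ∘ h) ξ i = ∑ j with φ j = i, cellCounts K h ξ j := by
  have hset : (φ ∘ h) ⁻¹' {i} ∩ K =
      ⋃ j ∈ Finset.univ.filter (fun j => φ j = i), h ⁻¹' {j} ∩ K := by
    ext x
    simp
  simp only [cellCounts]
  rw [hset, measure_biUnion_finset]
  · intro a _ b _ hab
    exact Set.disjoint_left.mpr fun x hx hy => hab (hx.1.symm.trans hy.1)
  · exact fun j _ => (hh (measurableSet_singleton j)).inter hK

/-- The events determined by the numbers of points in the cells, inside `K`, of a finite
measurable partition. -/
def cylinderSets (K : Set X) : Set (Set (PointMeasure X)) :=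
  {A | ∃ (n : ℕ) (f : X → Fin n), Measurable f ∧
    ∃ S : Set (Fin n → ℝ≥0∞), MeasurableSet S ∧ A = cellCounts K f ⁻¹' S}

/-- Counts in a coarser partition are sums of counts in a finer one. This lets two cylinder events
be expressed through a common refinement. -/
theorem preimage_cellCounts_comp {K : Set X} (hK : MeasurableSet K) {n k : ℕ} {h : X → Fin n}
    (hh : Measurable h) (φ : Fin n → Fin k) {S : Set (Fin k → ℝ≥0∞)} (hS : MeasurableSet S) :
    ∃ T : Set (Fin n → ℝ≥0∞), MeasurableSet T ∧
      cellCounts K (φ ∘ h) ⁻¹' S = cellCounts K h ⁻¹' T := by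
  have hm : Measurable fun (w : Fin n → ℝ≥0∞) (i : Fin k) => ∑ j with φ j = i, w j :=
    measurable_pi_lambda _ fun i => Finset.measurable_sum _ fun j _ => measurable_pi_apply j
  refine ⟨_, hm hS, ?_⟩
  rw [← Set.preimage_comp]
  congr 1
  funext ξ i
  exact cellCounts_comp hK hh φ ξ i

theorem isPiSystem_cylinderSets {K : Set X} (hK : MeasurableSet K) :
    IsPiSystem (cylinderSets K) := by
  rintro _ ⟨n, f, hf, S, hS, rfl⟩ _ ⟨k, g, hg, T, hT, rfl⟩ -
  have hh : Measurable fun x => finProdFinEquiv (f x, g x) :=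
    (measurable_of_finite _).comp (hf.prodMk hg)
  obtain ⟨S', hS', hSeq⟩ :=
    preimage_cellCounts_comp hK hh (fun j => (finProdFinEquiv.symm j).1) hS
  obtain ⟨T', hT', hTeq⟩ :=
    preimage_cellCounts_comp hK hh (fun j => (finProdFinEquiv.symm j).2) hT
  refine ⟨n * k, _, hh, S' ∩ T', hS'.inter hT', ?_⟩
  rw [Set.preimage_inter, ← hSeq, ← hTeq]
  congr 2 <;> · congr 1; funext x; simp only [Function.comp, Equiv.symm_apply_apply]

theorem restrictedSigma_eq_generateFrom (K : Set X) :
    restrictedSigma K = MeasurableSpace.generateFrom (cylinderSets K) := by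
  apply le_antisymm
  · refine Measurable.comap_le ?_
    refine @Measure.measurable_of_measurable_coe _ _ _ (MeasurableSpace.generateFrom _) _
      fun B hB => ?_
    classical
    -- A single count is a cylinder quantity: use the partition into `B` (cell 1) and its complement
    -- (cell 0).
    have hf : Measurable fun x => if x ∈ B then (1 : Fin 2) else 0 :=
      Measurable.ite hB measurable_const measurable_const
    intro S hS
    refine MeasurableSpace.measurableSet_generateFrom
      ⟨2, _, hf, (fun w => w 1) ⁻¹' S, measurable_pi_apply 1 hS, ?_⟩
    rw [← Set.preimage_comp]
    congr 1
    funext ξ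
    simp only [Measure.restrict_apply hB, Function.comp, cellCounts]
    congr 2
    ext x
    by_cases hx : x ∈ B <;> simp [hx]
  · refine MeasurableSpace.generateFrom_le ?_
    rintro _ ⟨n, f, hf, S, hS, rfl⟩
    have hm : Measurable fun (m : Measure X) (i : Fin n) => m (f ⁻¹' {i}) :=
      measurable_pi_lambda _ fun i => Measure.measurable_coe (hf (measurableSet_singleton i))
    refine ⟨_, hm hS, ?_⟩
    rw [← Set.preimage_comp]
    congr 1
    funext ξ i
    simp [cellCounts, Measure.restrict_apply (hf (measurableSet_singleton i))]

namespace IsPoissonLaw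

variable {μ : Measure X} {P Q : Measure (PointMeasure X)}

theorem iIndepFun_count (hP : IsPoissonLaw μ P) {ι : Type*} [Fintype ι] {B : ι → Set X}
    (hB : ∀ i, MeasurableSet (B i)) (hd : Pairwise (Function.onFun Disjoint B)) :
    iIndepFun (fun i (ξ : PointMeasure X) => ξ.1 (B i)) P := by
  have h := hP.indep (Fintype.card ι) (fun j => B ((Fintype.equivFin ι).symm j))
    (fun j => hB _) fun a b hab => hd ((Fintype.equivFin ι).symm.injective.ne hab)
  simpa using h.precomp (Fintype.equivFin ι).injective

theorem map_count_eq (hP : IsPoissonLaw μ P) (hQ : IsPoissonLaw μ Q) {B : Set X}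
    (hB : MeasurableSet B) : P.map (fun ξ => ξ.1 B) = Q.map (fun ξ => ξ.1 B) := by
  have := hP.isProbabilityMeasure
  have := hQ.isProbabilityMeasure
  by_cases hμ : μ B = ∞
  · have key : ∀ R : Measure (PointMeasure X), IsPoissonLaw μ R → IsProbabilityMeasure R →
        R.map (fun ξ => ξ.1 B) = Measure.dirac ∞ := fun R hR _ => by
      rw [Measure.map_congr (hR.count_infinite B hB hμ : _ =ᵐ[R] fun _ => ∞)]
      simp
    rw [key P hP inferInstance, key Q hQ inferInstance]
  · have key : ∀ R : Measure (PointMeasure X), IsPoissonLaw μ R → IsProbabilityMeasure R →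
        R.map (fun ξ => ξ.1 B) =
          (poissonMeasure (μ B).toNNReal).map (fun k : ℕ => (k : ℝ≥0∞)) := fun R hR _ => by
      have hc : Measurable fun k : ℕ => (k : ℝ≥0∞) := measurable_of_countable _
      have : IsProbabilityMeasure (R.map fun ξ => ξ.1 B) :=
        Measure.isProbabilityMeasure_map (measurable_count hB).aemeasurable
      have : IsProbabilityMeasure
          ((poissonMeasure (μ B).toNNReal).map (fun k : ℕ => (k : ℝ≥0∞))) :=
        Measure.isProbabilityMeasure_map hc.aemeasurable
      -- `count_finite` only gives the masses of the natural numbers, hence a lower bound on the law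
      -- of the count. Both sides have total mass one, so domination is equality.
      have hle : (poissonMeasure (μ B).toNNReal).map (fun k : ℕ => (k : ℝ≥0∞))
          ≤ R.map (fun ξ => ξ.1 B) := by
        refine Measure.le_iff.mpr fun S hS => ?_
        rw [Measure.map_apply hc hS, Measure.map_apply (measurable_count hB) hS]
        have hU : (fun ξ : PointMeasure X => ξ.1 B) ⁻¹'
            (⋃ k ∈ {k : ℕ | (k : ℝ≥0∞) ∈ S}, {(k : ℝ≥0∞)})
            ⊆ (fun ξ : PointMeasure X => ξ.1 B) ⁻¹' S := by
          refine Set.preimage_mono (Set.iUnion₂_subset fun k hk => ?_)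
          simpa using hk
        refine le_trans (le_of_eq ?_) (measure_mono hU)
        simp only [Set.preimage_iUnion]
        rw [measure_biUnion (Set.to_countable _)]
        · conv_lhs => rw [← Set.biUnion_of_singleton ((fun k : ℕ => (k : ℝ≥0∞)) ⁻¹' S)]
          rw [measure_biUnion (Set.to_countable _)]
          · exact tsum_congr fun k => (hR.count_finite B hB hμ k).symm
          · exact fun a _ b _ hab => Set.disjoint_singleton.mpr hab
          · exact fun _ _ => measurableSet_singleton _
        · intro a _ b _ hab
          refine Disjoint.preimage _ (Set.disjoint_singleton.mpr ?_)
          exact_mod_cast hab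
        · exact fun k _ => measurable_count hB (measurableSet_singleton _)
      exact (Measure.eq_of_le_of_isProbabilityMeasure hle).symm
    rw [key P hP inferInstance, key Q hQ inferInstance]

theorem map_cellCounts_eq (hP : IsPoissonLaw μ P) (hQ : IsPoissonLaw μ Q) {K : Set X}
    (hK : MeasurableSet K) {n : ℕ} {f : X → Fin n} (hf : Measurable f) :
    P.map (cellCounts K f) = Q.map (cellCounts K f) := by
  have := hP.isProbabilityMeasure
  have := hQ.isProbabilityMeasure
  have hB : ∀ i, MeasurableSet (f ⁻¹' {i} ∩ K) := fun i =>
    (hf (measurableSet_singleton i)).inter hK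
  have hd : Pairwise (Function.onFun Disjoint fun i => f ⁻¹' {i} ∩ K) := fun a b hab =>
    Set.disjoint_left.mpr fun x hx hy => hab (hx.1.symm.trans hy.1)
  have hPi := (iIndepFun_iff_map_fun_eq_pi_map
    fun i => (measurable_count (hB i)).aemeasurable).mp (hP.iIndepFun_count hB hd)
  have hQi := (iIndepFun_iff_map_fun_eq_pi_map
    fun i => (measurable_count (hB i)).aemeasurable).mp (hQ.iIndepFun_count hB hd)
  refine hPi.trans (Eq.trans ?_ hQi.symm)
  congr 1
  funext i
  exact hP.map_count_eq hQ (hB i)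

/-- The law of a Poisson point process is determined by its intensity. -/
theorem unique (hP : IsPoissonLaw μ P) (hQ : IsPoissonLaw μ Q) : P = Q := by
  have := hP.isProbabilityMeasure
  have := hQ.isProbabilityMeasure
  refine ext_of_generate_finite (cylinderSets Set.univ)
    (restrictedSigma_univ.symm.trans (restrictedSigma_eq_generateFrom Set.univ))
    (isPiSystem_cylinderSets .univ) ?_ (by simp)
  rintro _ ⟨n, f, hf, S, hS, rfl⟩
  rw [← Measure.map_apply (measurable_cellCounts .univ hf) hS, hP.map_cellCounts_eq hQ .univ hf,
    Measure.map_apply (measurable_cellCounts .univ hf) hS]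

/-- The restrictions of a Poisson point process to disjoint sets are independent. -/
theorem indep_restrictedSigma (hP : IsPoissonLaw μ P) {K L : Set X} (hK : MeasurableSet K)
    (hL : MeasurableSet L) (hKL : Disjoint K L) :
    Indep (restrictedSigma K) (restrictedSigma L) P := by
  have := hP.isProbabilityMeasure
  refine IndepSets.indep (restrictedSigma_le hK) (restrictedSigma_le hL)
    (isPiSystem_cylinderSets hK) (isPiSystem_cylinderSets hL) (restrictedSigma_eq_generateFrom K)
    (restrictedSigma_eq_generateFrom L) ?_
  rw [IndepSets_iff]
  rintro _ _ ⟨n, f, hf, S, hS, rfl⟩ ⟨k, g, hg, T, hT, rfl⟩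
  -- The cells in `K` and those in `L` form one disjoint family, so all counts are jointly
  -- independent; grouping them into two blocks gives the claim.
  let B : Fin n ⊕ Fin k → Set X := Sum.elim (fun i => f ⁻¹' {i} ∩ K) (fun j => g ⁻¹' {j} ∩ L)
  have hB : ∀ i, MeasurableSet (B i) := by
    rintro (i | j)
    · exact (hf (measurableSet_singleton i)).inter hK
    · exact (hg (measurableSet_singleton j)).inter hL
  have hd : Pairwise (Function.onFun Disjoint B) := by
    rintro (a | a) (b | b) hab
    · exact Set.disjoint_left.mpr fun x hx hy =>
        hab (congrArg Sum.inl (hx.1.symm.trans hy.1))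
    · exact hKL.mono Set.inter_subset_right Set.inter_subset_right
    · exact hKL.symm.mono Set.inter_subset_right Set.inter_subset_right
    · exact Set.disjoint_left.mpr fun x hx hy =>
        hab (congrArg Sum.inr (hx.1.symm.trans hy.1))
  have hfin := (hP.iIndepFun_count hB hd).indepFun_finset
    (Finset.univ.map Function.Embedding.inl) (Finset.univ.map Function.Embedding.inr)
    (by simp [Finset.disjoint_left]) fun i => measurable_count (hB i)
  have hcomp := hfin.comp
    (φ := fun w (i : Fin n) => w ⟨Sum.inl i, by simp⟩)
    (ψ := fun w (j : Fin k) => w ⟨Sum.inr j, by simp⟩)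
    (measurable_pi_lambda _ fun i => measurable_pi_apply _)
    (measurable_pi_lambda _ fun i => measurable_pi_apply _)
  exact hcomp.measure_inter_preimage_eq_mul S T hS hT

end IsPoissonLaw

/-- The events depending only on the points in some member of an exhausting sequence are dense. -/
theorem measureDense_restrictedSigma (P : Measure (PointMeasure X)) [IsFiniteMeasure P]
    {K : ℕ → Set X} (hK : ∀ n, MeasurableSet (K n)) (hmono : Monotone K)
    (hU : ⋃ n, K n = Set.univ) :
    P.MeasureDense {A | ∃ n, MeasurableSet[restrictedSigma (K n)] A} := by
  refine Measure.MeasureDense.of_generateFrom_isSetAlgebra_finite P ⟨?_, ?_, ?_⟩ ?_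
  · exact ⟨0, @MeasurableSet.empty _ (restrictedSigma (K 0))⟩
  · rintro A ⟨n, hA⟩
    exact ⟨n, hA.compl⟩
  · rintro A B ⟨n, hA⟩ ⟨k, hB⟩
    exact ⟨max n k, (restrictedSigma_mono (hK n) (hmono (le_max_left n k)) _ hA).union
      (restrictedSigma_mono (hK k) (hmono (le_max_right n k)) _ hB)⟩
  · apply le_antisymm
    · refine Measurable.comap_le ?_
      refine @Measure.measurable_of_measurable_coe _ _ _ (MeasurableSpace.generateFrom _) _
        fun B hB => ?_
      -- By continuity from below, every count is a supremum of counts that are each local.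
      have h : (fun ξ : PointMeasure X => ξ.1 B) = fun ξ => ⨆ n, ξ.1.restrict (K n) B := by
        funext ξ
        simp only [Measure.restrict_apply hB]
        rw [← Monotone.measure_iUnion fun a b hab => Set.inter_subset_inter_right B (hmono hab),
          ← Set.inter_iUnion, hU, Set.inter_univ]
      rw [h]
      refine Measurable.iSup fun n => ?_
      intro S hS
      exact MeasurableSpace.measurableSet_generateFrom ⟨n, _, Measure.measurable_coe hB hS, rfl⟩
    · refine MeasurableSpace.generateFrom_le ?_
      rintro A ⟨n, hA⟩
      exact restrictedSigma_le (hK n) _ hA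

end PointProcess

/-! ### Translations of the ellipses model. -/

theorem measurable_shift (x : Plane) : Measurable (shift x) :=
  (shift x).continuous.measurable

theorem measurable_translate (x : Plane) : Measurable (translate x) :=
  ((Measure.measurable_map _ (measurable_shift x)).comp measurable_subtype_coe).subtype_mk

theorem translate_apply (x : Plane) (ξ : PointMeasure EllipseSpace) {B : Set EllipseSpace}
    (hB : MeasurableSet B) : (translate x ξ).1 B = ξ.1 (shift x ⁻¹' B) :=
  Measure.map_apply (measurable_shift x) hB

theorem translate_neg_translate (x : Plane) (ξ : PointMeasure EllipseSpace) :
    translate (-x) (translate x ξ) = ξ := by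
  apply Subtype.ext
  change (ξ.1.map (shift x)).map (shift (-x)) = ξ.1
  rw [Measure.map_map (measurable_shift _) (measurable_shift _)]
  have h : shift (-x) ∘ shift x = id := by
    funext p
    exact Prod.ext (add_neg_cancel_right p.1 x) rfl
  rw [h, Measure.map_id]

theorem image_translate (x : Plane) (A : Set (PointMeasure EllipseSpace)) :
    translate x '' A = translate (-x) ⁻¹' A :=
  congrFun (Set.image_eq_preimage_of_inverse (translate_neg_translate x) fun ξ => by
    simpa using translate_neg_translate (-x) ξ) A

instance : SFinite directionLaw := by
  have : IsFiniteMeasure (Measure.comap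
      (Subtype.val : Set.Ioc (-(Real.pi / 2)) (Real.pi / 2) → ℝ) volume) := by
    refine ⟨?_⟩
    rw [(MeasurableEmbedding.subtype_coe measurableSet_Ioc).comap_apply,
      Set.image_univ, Subtype.range_coe]
    exact measure_Ioc_lt_top
  unfold directionLaw
  infer_instance

theorem map_shift_intensity (u : ℝ) (ρ : Measure (Set.Ici (1 : ℝ))) [SFinite ρ] (x : Plane) :
    (intensity u ρ).map (shift x) = intensity u ρ := by
  have h : (shift x : EllipseSpace → EllipseSpace) = Prod.map (fun z => z + x) id := rfl
  rw [h, intensity, ← Measure.map_prod_map _ _ (measurable_add_const x) measurable_id,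
    Measure.map_id, Measure.map_smul, map_add_right_eq_self]

theorem IsPoissonLaw.map_translate {μ : Measure EllipseSpace}
    {P : Measure (PointMeasure EllipseSpace)}
    (hP : IsPoissonLaw μ P) (x : Plane) :
    IsPoissonLaw (μ.map (shift x)) (P.map (translate x)) := by
  have := hP.isProbabilityMeasure
  have hx := measurable_translate x
  have hs := measurable_shift x
  refine ⟨Measure.isProbabilityMeasure_map hx.aemeasurable, fun B hB hμ k => ?_,
    fun B hB hμ => ?_, fun n B hB hd => ?_⟩
  · have hc : MeasurableSet {ξ : PointMeasure EllipseSpace | ξ.1 B = k} :=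
      measurable_count hB (measurableSet_singleton _)
    rw [Measure.map_apply hs hB] at hμ ⊢
    rw [Measure.map_apply hx hc, ← hP.count_finite _ (hs hB) hμ k]
    congr 1
    ext ξ
    simp [translate_apply x ξ hB]
  · have hc : MeasurableSet {ξ : PointMeasure EllipseSpace | ξ.1 B = ∞} :=
      measurable_count hB (measurableSet_singleton _)
    rw [Measure.map_apply hs hB] at hμ
    rw [ae_map_iff hx.aemeasurable hc]
    filter_upwards [hP.count_infinite _ (hs hB) hμ] with ξ hξ
    rwa [translate_apply x ξ hB]
  · have h := hP.indep n (fun i => shift x ⁻¹' B i) (fun i => hs (hB i))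
      fun a b hab => (hd hab).preimage _
    rw [iIndepFun_iff_measure_inter_preimage_eq_mul] at h ⊢
    intro S T hT
    have hT' : ∀ i ∈ S, MeasurableSet ((fun ξ : PointMeasure EllipseSpace => ξ.1 (B i)) ⁻¹' T i) :=
      fun i hi => measurable_count (hB i) (hT i hi)
    rw [Measure.map_apply hx (Finset.measurableSet_biInter S hT'),
      Finset.prod_congr rfl fun i hi => Measure.map_apply hx (hT' i hi)]
    simpa only [Set.preimage_iInter, ← Set.preimage_comp, Function.comp_def,
      translate_apply x _ (hB _)] using h S hT

theorem IsEllipsesModel.measurePreserving_translate {u : ℝ} {ρ : Measure (Set.Ici (1 : ℝ))}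
    [SFinite ρ] {P : Measure (PointMeasure EllipseSpace)} (hP : IsEllipsesModel u ρ P)
    (x : Plane) : MeasurePreserving (translate x) P P := by
  refine ⟨measurable_translate x, ?_⟩
  have h := IsPoissonLaw.map_translate hP x
  rw [map_shift_intensity] at h
  exact h.unique hP

/-- Restricting the translated configuration to `K` amounts to translating its restriction to `shift
x ⁻¹' K`. -/
theorem measurableSet_preimage_translate (x : Plane) {K : Set EllipseSpace}
    (hK : MeasurableSet K) {A : Set (PointMeasure EllipseSpace)}
    (hA : MeasurableSet[restrictedSigma K] A) :
    MeasurableSet[restrictedSigma (shift x ⁻¹' K)] (translate x ⁻¹' A) := by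
  obtain ⟨S, hS, rfl⟩ := hA
  refine ⟨_, Measure.measurable_map _ (measurable_shift x) hS, ?_⟩
  ext ξ
  simp only [Set.mem_preimage, translate, Measure.restrict_map (measurable_shift x) hK]

/-! ### Approximation by local events and decorrelation. -/

/-- The set of the ellipses with center in the closed ball of radius `n` around the origin. -/
def centeredIn (n : ℕ) : Set EllipseSpace := Prod.fst ⁻¹' Metric.closedBall 0 n

theorem measurableSet_centeredIn (n : ℕ) : MeasurableSet (centeredIn n) :=
  measurable_fst Metric.isClosed_closedBall.measurableSet

theorem monotone_centeredIn : Monotone centeredIn := fun _ _ h =>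
  Set.preimage_mono (Metric.closedBall_subset_closedBall (by exact_mod_cast h))

theorem iUnion_centeredIn : ⋃ n, centeredIn n = Set.univ := by
  simp only [centeredIn, ← Set.preimage_iUnion, Metric.iUnion_closedBall_nat, Set.preimage_univ]

theorem exists_disjoint_shift (n : ℕ) :
    ∃ x : Plane, Disjoint (centeredIn n) (shift x ⁻¹' centeredIn n) := by
  -- Two balls of radius `n` are disjoint once their centers are more than `2 * n` apart.
  obtain ⟨x, hx⟩ := NormedSpace.exists_lt_norm ℝ Plane (2 * n)
  refine ⟨x, Set.disjoint_left.mpr fun p hp hq => ?_⟩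
  have h1 : ‖p.1‖ ≤ n := by simpa [centeredIn] using hp
  have h2 : ‖p.1 + x‖ ≤ n := by simpa [centeredIn, shift] using hq
  have h3 : ‖x‖ ≤ ‖p.1 + x‖ + ‖p.1‖ := by simpa using norm_sub_le (p.1 + x) p.1
  linarith

/-- `P A = P (A ∩ translate x ⁻¹' A)` is within `2 * ε` of `P (B ∩ translate x ⁻¹' B) = (P B)²`,
itself within `2 * ε` of `(P A)²`. -/
theorem IsEllipsesModel.abs_measureReal_sub_sq_le {u : ℝ} {ρ : Measure (Set.Ici (1 : ℝ))}
    [SFinite ρ] {P : Measure (PointMeasure EllipseSpace)} (hP : IsEllipsesModel u ρ P)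
    {A : Set (PointMeasure EllipseSpace)} (hA : MeasurableSet A)
    (hinv : ∀ x : Plane, translate x ⁻¹' A =ᵐ[P] A) {ε : ℝ} (hε : 0 < ε) :
    |P.real A - P.real A ^ 2| ≤ 4 * ε := by
  have := IsPoissonLaw.isProbabilityMeasure hP
  obtain ⟨B, ⟨n, hB⟩, hAB⟩ := (measureDense_restrictedSigma P measurableSet_centeredIn
    monotone_centeredIn iUnion_centeredIn).approx A hA (measure_ne_top P A) ε hε
  have hBm : MeasurableSet B := restrictedSigma_le (measurableSet_centeredIn n) _ hB
  obtain ⟨x, hx⟩ := exists_disjoint_shift n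
  have hpres := hP.measurePreserving_translate x
  have hd : P.real (symmDiff A B) ≤ ε :=
    ENNReal.toReal_le_of_le_ofReal hε.le hAB.le
  have hd' : P.real (symmDiff (translate x ⁻¹' A) (translate x ⁻¹' B)) ≤ ε := by
    rw [← Set.preimage_symmDiff,
      hpres.measureReal_preimage (hA.symmDiff hBm).nullMeasurableSet]
    exact hd
  have hindep : P.real (B ∩ translate x ⁻¹' B) = P.real B ^ 2 := by
    have h := (Indep_iff _ _ _).mp (hP.indep_restrictedSigma (measurableSet_centeredIn n)
      (measurable_shift x (measurableSet_centeredIn n)) hx) _ _ hB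
      (measurableSet_preimage_translate x (measurableSet_centeredIn n) hB)
    rw [hpres.measure_preimage hBm.nullMeasurableSet] at h
    rw [measureReal_def, h, ENNReal.toReal_mul, sq]
    rfl
  have hAA : P.real (A ∩ translate x ⁻¹' A) = P.real A := by
    refine measureReal_congr ?_
    simpa using (Filter.EventuallyEq.refl _ A).inter (hinv x)
  have h1 : |P.real A - P.real B| ≤ ε :=
    (abs_measureReal_sub_le_measureReal_symmDiff hA.nullMeasurableSet
      hBm.nullMeasurableSet).trans hd
  have h2 : |P.real (A ∩ translate x ⁻¹' A) - P.real (B ∩ translate x ⁻¹' B)| ≤ 2 * ε := by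
    refine (abs_measureReal_sub_le_measureReal_symmDiff
      (hA.inter (measurable_translate x hA)).nullMeasurableSet
      (hBm.inter (measurable_translate x hBm)).nullMeasurableSet).trans ?_
    have hsub : symmDiff (A ∩ translate x ⁻¹' A) (B ∩ translate x ⁻¹' B) ⊆
        symmDiff A B ∪ symmDiff (translate x ⁻¹' A) (translate x ⁻¹' B) := by
      intro ξ
      simp only [Set.mem_symmDiff, Set.mem_union, Set.mem_inter_iff]
      tauto
    refine (measureReal_mono hsub).trans ((measureReal_union_le _ _).trans ?_)
    linarith
  rw [hAA, hindep] at h2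
  have ha := measureReal_le_one (μ := P) (s := A)
  have hb := measureReal_le_one (μ := P) (s := B)
  have ha0 : 0 ≤ P.real A := measureReal_nonneg
  have hb0 : 0 ≤ P.real B := measureReal_nonneg
  have h3 : |P.real B ^ 2 - P.real A ^ 2| ≤ 2 * ε := by
    -- The factor 2 bounds the sum of the two probabilities.
    rw [sq_sub_sq, abs_mul, abs_sub_comm (P.real B), abs_of_nonneg (by linarith)]
    exact mul_le_mul (by linarith) h1 (abs_nonneg _) (by norm_num)
  have h4 := abs_sub_le (P.real A) (P.real B ^ 2) (P.real A ^ 2)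
  linarith

end EllipsesModel

theorem mainTheorem8 (u α : ℝ) (hu : 0 < u) (hα : 0 < α)
    (ρ : MeasureTheory.Measure (Set.Ici (1 : ℝ))) (hρ : MeasureTheory.IsProbabilityMeasure ρ)
    (hdecay : EllipsesModel.HasTailDecay ρ α)
    (P : MeasureTheory.Measure (EllipsesModel.PointMeasure EllipsesModel.EllipseSpace))
    (hP : EllipsesModel.IsEllipsesModel u ρ P) :
    (∀ x : EllipsesModel.Plane,
      MeasureTheory.MeasurePreserving (EllipsesModel.translate x) P P) ∧
    ∀ A : Set (EllipsesModel.PointMeasure EllipsesModel.EllipseSpace), MeasurableSet A →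
      (∀ x : EllipsesModel.Plane, EllipsesModel.translate x '' A =ᵐ[P] A) →
      P A = 0 ∨ P A = 1 := by
  refine ⟨hP.measurePreserving_translate, fun A hA hinv => ?_⟩
  have := EllipsesModel.IsPoissonLaw.isProbabilityMeasure hP
  have hinv' : ∀ x : EllipsesModel.Plane, EllipsesModel.translate x ⁻¹' A =ᵐ[P] A := fun x => by
    have h := hinv (-x)
    rwa [EllipsesModel.image_translate, neg_neg] at h
  have h0 : P.real A - P.real A ^ 2 = 0 := by
    refine abs_nonpos_iff.mp (le_of_forall_pos_le_add fun ε hε => ?_)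
    have h := hP.abs_measureReal_sub_sq_le hA hinv' (ε := ε / 4) (by linarith)
    linarith
  have h1 : P.real A * (1 - P.real A) = 0 := by linarith
  rcases mul_eq_zero.mp h1 with h | h
  · exact Or.inl ((measureReal_eq_zero_iff).mp h)
  · right
    rw [← ofReal_measureReal (μ := P) (s := A), show P.real A = 1 by linarith,
      ENNReal.ofReal_one]
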